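/- Let $\mathbb N$ be the set of positive integers and let $\mathbb N^2_{\leqslant}$ be $\mathbb N\times\mathbb N$ with the componentwise order. Let $\mathscr{PO}_\infty(\mathbb N^2_{\leqslant})$ be the monoid of all injective partial maps $\alpha\colon\mathbb N\times\mathbb N\rightharpoonup\mathbb N\times\mathbb N$ that are monotone (if $x,y\in\operatorname{dom}\alpha$ and $x\leqslant y$, then $(x)\alpha\leqslant (y)\alpha$) and for which the complements of $\operatorname{dom}\alpha$ and $\operatorname{ran}\alpha$ in $\mathbb N\times\mathbb N$ are finite, with the composition of partial maps $x(\alpha\beta)=(x\alpha)\beta$ as multiplication. Let $\sigma$ be the congruence on $\mathscr{PO}_\infty(\mathbb N^2_{\leqslant})$ given by: $\alpha\,\sigma\,\beta$ if and only if $\alpha\varepsilon=\beta\varepsilon$ for some idempotent $\varepsilon\in\mathscr{PO}_\infty(\mathbb N^2_{\leqslant})$. Let $\mathfrak{AM}_\omega$ be the free commutative monoid over the countably infinite set $\{a_i : i\in\mathbb N\}\sqcup\{b_i : i\in\mathbb N\}$, and let $\mathfrak f$ be the automorphism of $\mathfrak{AM}_\omega$ with $(a_i)\mathfrak f=b_i$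 and $(b_i)\mathfrak f=a_i$ for every $i\in\mathbb N$. Let the cyclic group $\mathbb Z_2=\{\bar 0,\bar 1\}$ act on $\mathfrak{AM}_\omega$ by letting $\mathfrak h_{\bar 0}$ be the identity and $\mathfrak h_{\bar 1}=\mathfrak f$, and let $\mathfrak{AM}_\omega\rtimes\mathbb Z_2$ be the corresponding semidirect product, that is, the set $\mathfrak{AM}_\omega\times\mathbb Z_2$ with the multiplication $(u,g)\cdot(v,k)=\bigl(u\cdot(v)\mathfrak h_{g},\,g k\bigr)$, where $gk$ denotes the product in the group $\mathbb Z_2$ (that is, addition modulo $2$). Then the quotient semigroup $\mathscr{PO}_\infty(\mathbb N^2_{\leqslant})/\sigma$ is isomorphic to $\mathfrak{AM}_\omega\rtimes\mathbb Z_2$. -/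

import Mathlib

/-- The monoid of all partial injective self-maps `α` of the poset `ℕ+ × ℕ+`
(positive integers, componentwise order) that are monotone on their domain and whose
domain and range are cofinite. -/
@[ext]
structure POInf where
  /-- the underlying partial injection -/
  map : (ℕ+ × ℕ+) ≃. (ℕ+ × ℕ+)
  monotone' : ∀ x y x' y' : ℕ+ × ℕ+, x' ∈ map x → y' ∈ map y → x ≤ y → x' ≤ y'
  cofinite_dom : {x : ℕ+ × ℕ+ | ∃ y, y ∈ map x}ᶜ.Finite
  cofinite_ran : {y : ℕ+ × ℕ+ | ∃ x, y ∈ map x}ᶜ.Finite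

namespace POInf

/-- Preimages of cofinite sets under a partial injection with cofinite domain are cofinite. -/
theorem finite_compl_comp (f g : (ℕ+ × ℕ+) ≃. (ℕ+ × ℕ+))
    (hf : {x : ℕ+ × ℕ+ | ∃ y, y ∈ f x}ᶜ.Finite)
    (hg : {x : ℕ+ × ℕ+ | ∃ y, y ∈ g x}ᶜ.Finite) :
    {x : ℕ+ × ℕ+ | ∃ z, z ∈ f.trans g x}ᶜ.Finite := by
  have h : {x : ℕ+ × ℕ+ | ∃ y ∈ {y : ℕ+ × ℕ+ | ∃ z, z ∈ g y}ᶜ, y ∈ f x}.Finite := by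
    have : {x : ℕ+ × ℕ+ | ∃ y ∈ {y : ℕ+ × ℕ+ | ∃ z, z ∈ g y}ᶜ, y ∈ f x} ⊆
        (⋃ y ∈ {y : ℕ+ × ℕ+ | ∃ z, z ∈ g y}ᶜ, {x | y ∈ f x}) := by
      intro x hx
      simpa using hx
    refine (hg.biUnion fun y _ => ?_).subset this
    exact Set.Subsingleton.finite fun a ha b hb => f.inj ha hb
  refine (hf.union h).subset fun x hx => ?_
  by_cases hx' : ∃ y, y ∈ f x
  · obtain ⟨y, hy⟩ := hx'
    refine Or.inr ⟨y, ?_, hy⟩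
    rintro ⟨z, hz⟩
    exact hx ⟨z, (PEquiv.mem_trans f g x z).2 ⟨y, hy, hz⟩⟩
  · exact Or.inl hx'

/-- The product `α * β` is "first `α`, then `β`": `x (α β) = (x α) β`, with domain the set of
all `x` in the domain of `α` such that `x α` is in the domain of `β`. -/
instance : Mul POInf where
  mul α β :=
    { map := α.map.trans β.map
      monotone' := by
        intro x y x' y' hx hy hxy
        obtain ⟨u, hu, hu'⟩ := (PEquiv.mem_trans _ _ _ _).1 hx
        obtain ⟨v, hv, hv'⟩ := (PEquiv.mem_trans _ _ _ _).1 hy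
        exact β.monotone' u v x' y' hu' hv' (α.monotone' x y u v hu hv hxy)
      cofinite_dom := finite_compl_comp _ _ α.cofinite_dom β.cofinite_dom
      cofinite_ran := by
        have h := finite_compl_comp β.map.symm α.map.symm
          (by simpa only [PEquiv.mem_iff_mem] using β.cofinite_ran)
          (by simpa only [PEquiv.mem_iff_mem] using α.cofinite_ran)
        rw [← PEquiv.symm_trans_rev] at h
        simpa only [PEquiv.mem_iff_mem] using h }

/-- The identity map of `ℕ+ × ℕ+`. -/
instance : One POInf where
  one :=
    { map := PEquiv.refl _
      monotone' := by
        intro x y x' y' hx hy hxy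
        simp only [PEquiv.refl_apply, Option.mem_def, Option.some.injEq] at hx hy
        exact hx ▸ hy ▸ hxy
      cofinite_dom := by simp
      cofinite_ran := by simp }

theorem mul_map (α β : POInf) : (α * β).map = α.map.trans β.map := rfl

instance : Monoid POInf where
  mul_assoc α β γ := POInf.ext (PEquiv.trans_assoc _ _ _)
  one_mul α := POInf.ext (PEquiv.refl_trans _)
  mul_one α := POInf.ext (PEquiv.trans_refl _)

/-- An idempotent of the monoid is a partial identity map. -/
theorem eq_of_idempotent {ε : POInf} (hε : IsIdempotentElem ε) {x y : ℕ+ × ℕ+}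
    (h : y ∈ ε.map x) : y = x := by
  have h' : y ∈ (ε * ε).map x := by rw [hε.eq]; exact h
  obtain ⟨z, hz, hz'⟩ := (PEquiv.mem_trans _ _ _ _).1 h'
  have h1 : z = y := Option.mem_unique hz h
  subst h1
  exact ε.map.inj hz' h

/-- Elements with the same graph are equal. -/
theorem ext_mem {α β : POInf} (h : ∀ x y, y ∈ α.map x ↔ y ∈ β.map x) : α = β :=
  POInf.ext (PEquiv.ext fun x => Option.ext fun y => h x y)

theorem mem_mul_idempotent {α ε : POInf} (hε : IsIdempotentElem ε) {x y : ℕ+ × ℕ+} :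
    y ∈ (α * ε).map x ↔ y ∈ α.map x ∧ y ∈ ε.map y := by
  rw [mul_map, PEquiv.mem_trans]
  constructor
  · rintro ⟨z, hz, hz'⟩
    obtain rfl := eq_of_idempotent hε hz'
    exact ⟨hz, hz'⟩
  · rintro ⟨h1, h2⟩
    exact ⟨y, h1, h2⟩

theorem mem_idempotent_mul {α ε : POInf} (hε : IsIdempotentElem ε) {x y : ℕ+ × ℕ+} :
    y ∈ (ε * α).map x ↔ x ∈ ε.map x ∧ y ∈ α.map x := by
  rw [mul_map, PEquiv.mem_trans]
  constructor
  · rintro ⟨z, hz, hz'⟩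
    obtain rfl := eq_of_idempotent hε hz
    exact ⟨hz, hz'⟩
  · rintro ⟨h1, h2⟩
    exact ⟨x, h1, h2⟩

theorem idempotent_comm {ε ι : POInf} (hε : IsIdempotentElem ε) (hι : IsIdempotentElem ι) :
    ε * ι = ι * ε := by
  refine ext_mem fun x y => ?_
  rw [mem_mul_idempotent hι, mem_idempotent_mul hι]
  constructor
  · rintro ⟨h1, h2⟩
    obtain rfl := eq_of_idempotent hε h1
    exact ⟨h2, h1⟩
  · rintro ⟨h1, h2⟩
    obtain rfl := eq_of_idempotent hε h2
    exact ⟨h2, h1⟩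

theorem idempotent_mul {ε ι : POInf} (hε : IsIdempotentElem ε) (hι : IsIdempotentElem ι) :
    IsIdempotentElem (ε * ι) :=
  hε.mul_of_commute (idempotent_comm hε hι) hι

/-- An idempotent can be moved from the left to the right of an element. -/
theorem exists_idempotent_swap (γ : POInf) {ε : POInf} (hε : IsIdempotentElem ε) :
    ∃ ι : POInf, IsIdempotentElem ι ∧ γ * ι = ε * γ := by
  classical
  let s : Set (ℕ+ × ℕ+) := {y | ∃ x, y ∈ (ε * γ).map x}
  have hs : ∀ x y, y ∈ PEquiv.ofSet s x ↔ x = y ∧ x ∈ s := fun x y => by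
    rw [PEquiv.mem_ofSet_iff, eq_comm]
    exact ⟨fun h => ⟨h.1, h.1.symm ▸ h.2⟩, fun h => ⟨h.1, h.1 ▸ h.2⟩⟩
  have hdom : {x : ℕ+ × ℕ+ | ∃ y, y ∈ PEquiv.ofSet s x} = s := by
    ext x; simp [hs]
  have hran : {y : ℕ+ × ℕ+ | ∃ x, y ∈ PEquiv.ofSet s x} = s := by
    ext x; simp [hs]
  let ι : POInf :=
    { map := PEquiv.ofSet s
      monotone' := by
        intro x y x' y' hx hy hxy
        obtain ⟨rfl, -⟩ := (hs _ _).1 hx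
        obtain ⟨rfl, -⟩ := (hs _ _).1 hy
        exact hxy
      cofinite_dom := by rw [hdom]; exact (ε * γ).cofinite_ran
      cofinite_ran := by rw [hran]; exact (ε * γ).cofinite_ran }
  have hι : ∀ x y, y ∈ ι.map x ↔ x = y ∧ x ∈ s := hs
  have hid : IsIdempotentElem ι := by
    refine ext_mem fun x y => ?_
    rw [mul_map, PEquiv.mem_trans]
    constructor
    · rintro ⟨z, hz, hz'⟩
      obtain ⟨rfl, -⟩ := (hι _ _).1 hz
      exact hz'
    · intro h
      obtain ⟨rfl, -⟩ := (hι _ _).1 h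
      exact ⟨x, h, h⟩
  refine ⟨ι, hid, ext_mem fun x y => ?_⟩
  rw [mem_mul_idempotent hid, hι]
  constructor
  · rintro ⟨h1, -, x', hx'⟩
    have h2 := ((mem_idempotent_mul hε).1 hx').2
    obtain rfl := γ.map.inj h1 h2
    exact hx'
  · intro h
    exact ⟨((mem_idempotent_mul hε).1 h).2, rfl, x, h⟩

/-- The congruence `σ`: `α σ β` if and only if `α ε = β ε` for some idempotent `ε`. -/
def sigma : Con POInf where
  r α β := ∃ ε : POInf, IsIdempotentElem ε ∧ α * ε = β * ε
  iseqv :=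
    { refl := fun α => ⟨1, IsIdempotentElem.one, rfl⟩
      symm := fun ⟨ε, hε, h⟩ => ⟨ε, hε, h.symm⟩
      trans := by
        rintro α β γ ⟨ε, hε, h⟩ ⟨ι, hι, h'⟩
        refine ⟨ε * ι, idempotent_mul hε hι, ?_⟩
        rw [← mul_assoc, h, mul_assoc, idempotent_comm hε hι, ← mul_assoc, h', mul_assoc] }
  mul' := by
    rintro α β γ δ ⟨ε, hε, h⟩ ⟨ι, hι, h'⟩
    obtain ⟨κ, hκ, hk⟩ := exists_idempotent_swap γ hε
    refine ⟨κ * ι, idempotent_mul hκ hι, ?_⟩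
    calc α * γ * (κ * ι) = α * (γ * κ) * ι := by simp only [mul_assoc]
      _ = α * ε * (γ * ι) := by rw [hk]; simp only [mul_assoc]
      _ = β * (ε * γ) * ι := by rw [h]; simp only [mul_assoc]
      _ = β * (γ * ι) * κ := by
        rw [← hk]; simp only [mul_assoc]; rw [idempotent_comm hκ hι]
      _ = β * δ * (κ * ι) := by
        rw [h', idempotent_comm hκ hι]; simp only [mul_assoc]

end POInf

/-- The free commutative monoid on the countably infinite set of generators
`{a_i : i ∈ ℕ+} ∪ {b_i : i ∈ ℕ+}`, written multiplicatively: its elements are the monomials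
`∏ a_i ^ (m_i) * ∏ b_i ^ (n_i)`, encoded by their finitely supported exponent function. The index
`Sum.inl i` stands for `a_i`, the index `Sum.inr i` for `b_i`. -/
abbrev FreeAM : Type := Multiplicative ((ℕ+ ⊕ ℕ+) →₀ ℕ)

/-- The automorphism of the free commutative monoid that exchanges `a_i` and `b_i` for all `i`. -/
noncomputable def FreeAM.swap : MulAut FreeAM :=
  AddEquiv.toMultiplicative (Finsupp.domCongr (Equiv.sumComm ℕ+ ℕ+))

theorem FreeAM.swap_mul_swap : FreeAM.swap * FreeAM.swap = 1 := by
  ext u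
  simp [FreeAM.swap]

/-- The action of the cyclic group `ℤ₂ = {0, 1}` (written multiplicatively) on the free commutative
monoid: `0` acts as the identity and `1` acts as the swap. -/
noncomputable def FreeAM.action : Multiplicative (ZMod 2) →* MulAut FreeAM where
  toFun g := if g = Multiplicative.ofAdd 0 then 1 else FreeAM.swap
  map_one' := if_pos rfl
  map_mul' := by
    have h : ∀ g : Multiplicative (ZMod 2),
        g = Multiplicative.ofAdd 0 ∨ g = Multiplicative.ofAdd 1 := by decide
    have h2 : Multiplicative.ofAdd (1 : ZMod 2) * Multiplicative.ofAdd 1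
        = Multiplicative.ofAdd 0 := by decide
    intro g k
    rcases h g with rfl | rfl <;> rcases h k with rfl | rfl <;>
      simp [h2, FreeAM.swap_mul_swap]

/-- The semidirect product `S ⋊ T` of a monoid `S` by a group `T` that acts on `S` by automorphisms
`φ t`: the set `S × T` with the product `(s₁, t₁) (s₂, t₂) = (s₁ · φ t₁ s₂, t₁ t₂)`. -/
@[ext]
structure MonoidSemidirect (S T : Type*) [Monoid S] [Group T] (φ : T →* MulAut S) where
  left : S
  right : T

namespace MonoidSemidirect

variable {S T : Type*} [Monoid S] [Group T] {φ : T →* MulAut S}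

instance : Mul (MonoidSemidirect S T φ) where
  mul p q := ⟨p.left * φ p.right q.left, p.right * q.right⟩

instance : One (MonoidSemidirect S T φ) where
  one := ⟨1, 1⟩

theorem mul_def (p q : MonoidSemidirect S T φ) :
    p * q = ⟨p.left * φ p.right q.left, p.right * q.right⟩ := rfl

theorem one_def : (1 : MonoidSemidirect S T φ) = ⟨1, 1⟩ := rfl

instance : Monoid (MonoidSemidirect S T φ) where
  mul_assoc p q r := by simp [mul_def, mul_assoc]
  one_mul p := by simp [mul_def, one_def]
  mul_one p := by simp [mul_def, one_def]

end MonoidSemidirect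

/-!
The quotient by `σ` remembers a partial map only up to finite sets, so the point is to find the
possible behaviours of a cofinite monotone partial injection `α` near infinity. The result is that,
outside a finite set and up to an exchange of the two coordinates, `α` keeps every column and every
row in place, moves column `i` down by `m i` and row `j` to the left by `n j`, where `m` and `n` are
decreasing and eventually zero. Such a sequence `m` is determined by its successive differences,
which can be arbitrary finitely supported functions; they are the exponents of the generators
`a_i`, and those of `n` are the exponents of the `b_i`. Composition adds the shifts, and moving an
exchange of coordinates past a shift interchanges `m` and `n`, which is the multiplication of the
semidirect product.

The normal form is proved as follows.

* The level `x.1 + x.2` cannot increase (`CofiniteMono.level_le`): preimages of antichains are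
  antichains, and the points that are not above `x` are covered by `x.1 + x.2` chains.
* Far from both axes the level is preserved (`CofiniteMono.level_eq`), by counting points in a
  triangle. Covers then go to covers, so there `α` is a translation, possibly composed with the
  exchange of coordinates (`CofiniteMono.eq_translation`).
* On each column the level drop is decreasing and hence eventually constant, so the column `i` is
  eventually shifted into some column `k i`. The sequence `k` is strictly increasing, so `i ≤ k i`.
  This and the same fact for rows show that the translation is trivial; then `k i = i` for large
  `i`, and therefore for all `i` (`CofiniteMono.columns`).

Every partial map thus has a normal form (`POInf.exists_normalForm`). It is unique, multiplicative,
and arbitrary (`POInf.HasNormalForm.unique`, `POInf.HasNormalForm.mul`,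
`POInf.exists_of_normalForm`), so it defines a surjective homomorphism to the semidirect product,
whose kernel is `σ` (`POInf.sigma_eq_ker`).
-/

/-! ### Cofinite monotone injections of the quadrant `ℕ × ℕ` -/

/-- `f` restricts to a monotone injection of the complement of the box `[0, M)²` whose image
is cofinite. Nothing is required of the values of `f` inside the box. -/
structure CofiniteMono (M : ℕ) (f : ℕ × ℕ → ℕ × ℕ) : Prop where
  mono : ∀ x y : ℕ × ℕ, (M ≤ x.1 ∨ M ≤ x.2) → x ≤ y → f x ≤ f y
  inj : ∀ x y : ℕ × ℕ, (M ≤ x.1 ∨ M ≤ x.2) → (M ≤ y.1 ∨ M ≤ y.2) → f x = f y → x = y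
  surj : ∃ L : ℕ, ∀ y : ℕ × ℕ, (L ≤ y.1 ∨ L ≤ y.2) → ∃ x, (M ≤ x.1 ∨ M ≤ x.2) ∧ f x = y

namespace CofiniteMono

variable {M : ℕ} {f : ℕ × ℕ → ℕ × ℕ}

theorem swap_comp (h : CofiniteMono M f) : CofiniteMono M (fun x => (f x).swap) where
  mono x y hx hxy := Prod.swap_le_swap.2 (h.mono x y hx hxy)
  inj x y hx hy e := h.inj x y hx hy (Prod.swap_injective e)
  surj := by
    obtain ⟨L, hL⟩ := h.surj
    refine ⟨L, fun y hy => ?_⟩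
    obtain ⟨x, hx, e⟩ := hL y.swap hy.symm
    exact ⟨x, hx, by rw [e, Prod.swap_swap]⟩

theorem comp_swap (h : CofiniteMono M f) : CofiniteMono M (fun x => f x.swap) where
  mono x y hx hxy := h.mono _ _ hx.symm (Prod.swap_le_swap.2 hxy)
  inj x y hx hy e := Prod.swap_injective (h.inj _ _ hx.symm hy.symm e)
  surj := by
    obtain ⟨L, hL⟩ := h.surj
    refine ⟨L, fun y hy => ?_⟩
    obtain ⟨x, hx, e⟩ := hL y hy
    exact ⟨x.swap, hx.symm, by rw [Prod.swap_swap, e]⟩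

/-- The level `x.1 + x.2` does not increase. The points of a far antidiagonal that are not above
`f x` form an antichain of `(f x).1 + (f x).2` elements. Preimages of incomparable points are
incomparable, so their preimages form an antichain of points not above `x`; these are covered by
`x.1 + x.2` chains, namely columns and rows. -/
theorem level_le (h : CofiniteMono M f) (x : ℕ × ℕ) (hx : M ≤ x.1 ∨ M ≤ x.2) :
    (f x).1 + (f x).2 ≤ x.1 + x.2 := by
  obtain ⟨L, hL⟩ := h.surj
  set p := (f x).1 with hp
  set q := (f x).2 with hq
  let S := 2 * L + p + q + 1
  let c : ℕ ⊕ ℕ → ℕ × ℕ := Sum.elim (fun k => (k, S - k)) (fun l => (S - l, l))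
  have hpre : ∀ s : ℕ ⊕ ℕ, ∃ y, (M ≤ y.1 ∨ M ≤ y.2) ∧ f y = c s := by
    intro s
    apply hL
    rcases s with k | l <;> simp only [c, S, Sum.elim_inl, Sum.elim_inr] <;> omega
  choose y hyE hyc using hpre
  let A : Finset (ℕ ⊕ ℕ) := (Finset.range p).disjSum (Finset.range q)
  let B : Finset (ℕ ⊕ ℕ) := (Finset.range x.1).disjSum (Finset.range x.2)
  let lab : ℕ ⊕ ℕ → ℕ ⊕ ℕ := fun s => if (y s).1 < x.1 then Sum.inl (y s).1 else Sum.inr (y s).2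
  have hle : ∀ s ∈ A, ∀ t ∈ A, y s ≤ y t → s = t := by
    intro s hs t ht hst
    have h1 := h.mono _ _ (hyE s) hst
    rw [hyc, hyc] at h1
    rcases s with k | k <;> rcases t with l | l <;>
      simp only [A, Finset.inl_mem_disjSum, Finset.inr_mem_disjSum, Finset.mem_range] at hs ht <;>
      simp only [c, S, Sum.elim_inl, Sum.elim_inr, Prod.mk_le_mk] at h1
    · congr 1; omega
    · omega
    · omega
    · congr 1; omega
  have hmaps : ∀ s ∈ A, lab s ∈ B := by
    intro s hs
    by_cases hc : (y s).1 < x.1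
    · simp [lab, B, hc]
    · simp only [lab, B, hc, if_false, Finset.inr_mem_disjSum, Finset.mem_range]
      by_contra hc2
      have h1 := h.mono x (y s) hx ⟨not_lt.1 hc, not_lt.1 hc2⟩
      rw [hyc, Prod.le_def, ← hp, ← hq] at h1
      rcases s with k | k <;>
        simp only [A, Finset.inl_mem_disjSum, Finset.inr_mem_disjSum, Finset.mem_range] at hs <;>
        simp only [c, S, Sum.elim_inl, Sum.elim_inr] at h1 <;> omega
  have hinj : Set.InjOn lab A := by
    intro s hs t ht e
    by_cases hs1 : (y s).1 < x.1 <;> by_cases ht1 : (y t).1 < x.1 <;>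
      simp only [lab, hs1, ht1, if_true, if_false, Sum.inl.injEq, Sum.inr.injEq, reduceCtorEq] at e
    · rcases le_total (y s).2 (y t).2 with h2 | h2
      · exact hle s hs t ht ⟨e.le, h2⟩
      · exact (hle t ht s hs ⟨e.ge, h2⟩).symm
    · rcases le_total (y s).1 (y t).1 with h2 | h2
      · exact hle s hs t ht ⟨h2, e.le⟩
      · exact (hle t ht s hs ⟨h2, e.ge⟩).symm
  have := Finset.card_le_card_of_injOn lab hmaps hinj
  simpa [A, B] using this

/-- A monotone injection increases the level by at least one along each covering pair. -/
theorem level_add_le (h : CofiniteMono M f) (a b s t : ℕ) (hx : M ≤ a ∨ M ≤ b) :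
    (f (a, b)).1 + (f (a, b)).2 + (s + t) ≤ (f (a + s, b + t)).1 + (f (a + s, b + t)).2 := by
  have step : ∀ x y : ℕ × ℕ, (M ≤ x.1 ∨ M ≤ x.2) → x ≤ y → x ≠ y →
      (f x).1 + (f x).2 + 1 ≤ (f y).1 + (f y).2 := by
    intro x y hx hxy hne
    have h1 := h.mono x y hx hxy
    have h2 : f x ≠ f y := fun e => hne (h.inj x y hx
      (hx.imp (fun h => h.trans hxy.1) (fun h => h.trans hxy.2)) e)
    rw [Ne, Prod.ext_iff] at h2
    have := h1.1
    have := h1.2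
    omega
  induction s with
  | zero =>
    induction t with
    | zero => simp
    | succ t ih =>
      have := step (a + 0, b + t) (a + 0, b + (t + 1)) (by simp only; omega)
        ⟨le_rfl, by simp only; omega⟩ (by simp)
      omega
  | succ s ih =>
    have := step (a + s, b + t) (a + (s + 1), b + t) (by simp only; omega)
      ⟨by simp only; omega, le_rfl⟩ (by simp)
    omega

/-- Far from both axes the level is preserved. Otherwise `f` would lower the level of every
point of a triangle `x.1 + x.2 ≤ N` outside the box, which leaves too few possible values. -/
theorem level_eq (h : CofiniteMono M f) (x : ℕ × ℕ) (h1 : M + M * M ≤ x.1) (h2 : M + M * M ≤ x.2) :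
    (f x).1 + (f x).2 = x.1 + x.2 := by
  classical
  refine le_antisymm (h.level_le x (by omega)) ?_
  by_contra! hlt
  set N := M + M * M with hN
  let T : Finset (ℕ × ℕ) := ((Finset.range N) ×ˢ (Finset.range N)).filter (fun y => y.1 + y.2 < N)
  let U : Finset (ℕ × ℕ) := T ∪ Finset.HasAntidiagonal.antidiagonal N
  let box : Finset (ℕ × ℕ) := Finset.range M ×ˢ Finset.range M
  have hU : U.card = T.card + (N + 1) := by
    rw [Finset.card_union_of_disjoint, Finset.Nat.card_antidiagonal]
    rw [Finset.disjoint_left]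
    intro y hy hy'
    simp only [T, Finset.mem_filter, Finset.HasAntidiagonal.mem_antidiagonal] at hy hy'
    omega
  have hmaps : ∀ y ∈ U \ box, f y ∈ T := by
    rintro ⟨a, b⟩ hy
    simp only [U, T, box, Finset.mem_sdiff, Finset.mem_union, Finset.mem_filter,
      Finset.mem_product, Finset.mem_range, Finset.HasAntidiagonal.mem_antidiagonal] at hy ⊢
    have := h.level_add_le a b (x.1 - a) (x.2 - b) (by omega)
    rw [show a + (x.1 - a) = x.1 by omega, show b + (x.2 - b) = x.2 by omega] at this
    simp only [Prod.mk.eta] at this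
    omega
  have hinj : Set.InjOn f (U \ box : Finset (ℕ × ℕ)) := by
    intro y hy z hz e
    simp only [box, Finset.coe_sdiff, Set.mem_sdiff, Finset.mem_coe,
      Finset.mem_product, Finset.mem_range] at hy hz
    exact h.inj y z (by omega) (by omega) e
  have h3 := Finset.card_le_card_of_injOn f hmaps hinj
  have h4 := Finset.le_card_sdiff box U
  have h5 : box.card = M * M := by simp [box]
  omega

/-- Suppose that `f` preserves the level on the quadrant above `(N, N)`. If the first horizontal
step is mapped to a horizontal step, then so are all of them, and `f` is a translation there: the
two covers of a point are mapped to the two covers of its image, and their join to the join. -/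
theorem eq_translation (h : CofiniteMono M f) {N : ℕ} (hMN : M ≤ N)
    (hlev : ∀ x : ℕ × ℕ, N ≤ x.1 → N ≤ x.2 → (f x).1 + (f x).2 = x.1 + x.2)
    (h0 : (f (N + 1, N)).1 = (f (N, N)).1 + 1) (s t : ℕ) :
    f (N + s, N + t) = ((f (N, N)).1 + s, (f (N, N)).2 + t) := by
  have hm : ∀ a b c d : ℕ, N ≤ a → N ≤ b → a ≤ c → b ≤ d →
      (f (a, b)).1 ≤ (f (c, d)).1 ∧ (f (a, b)).2 ≤ (f (c, d)).2 := fun a b c d ha hb hac hbd =>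
    h.mono (a, b) (c, d) (by simp only; omega) ⟨hac, hbd⟩
  have hi : ∀ a b : ℕ, N ≤ a → N ≤ b →
      ¬ ((f (a + 1, b)).1 = (f (a, b + 1)).1 ∧ (f (a + 1, b)).2 = (f (a, b + 1)).2) := by
    intro a b ha hb e
    have := h.inj (a + 1, b) (a, b + 1) (by simp only; omega) (by simp only; omega)
      (Prod.ext e.1 e.2)
    simp at this
  have hl : ∀ a b : ℕ, N ≤ a → N ≤ b → (f (a, b)).1 + (f (a, b)).2 = a + b :=
    fun a b ha hb => hlev (a, b) ha hb
  have key : ∀ a b : ℕ, N ≤ a → N ≤ b → (f (a + 1, b)).1 = (f (a, b)).1 + 1 →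
      (f (a, b + 1)).1 = (f (a, b)).1 ∧ (f (a + 1 + 1, b)).1 = (f (a + 1, b)).1 + 1 ∧
      (f (a + 1, b + 1)).1 = (f (a, b + 1)).1 + 1 := by
    intro a b ha hb e
    have l1 := hl a b ha hb
    have l2 := hl (a + 1) b (by omega) hb
    have l3 := hl a (b + 1) ha (by omega)
    have l4 := hl (a + 1) (b + 1) (by omega) (by omega)
    have l5 := hl (a + 1 + 1) b (by omega) hb
    have m1 := hm a b a (b + 1) ha hb le_rfl (by omega)
    have m2 := hm (a + 1) b (a + 1) (b + 1) (by omega) hb le_rfl (by omega)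
    have m3 := hm a (b + 1) (a + 1) (b + 1) ha (by omega) (by omega) le_rfl
    have m4 := hm (a + 1) b (a + 1 + 1) b (by omega) hb (by omega) le_rfl
    have i1 := hi a b ha hb
    have i2 := hi (a + 1) b (by omega) hb
    omega
  have horiz : ∀ s t : ℕ, (f (N + s + 1, N + t)).1 = (f (N + s, N + t)).1 + 1 := by
    intro s t
    induction t with
    | zero =>
      induction s with
      | zero => exact h0
      | succ s ih => exact (key (N + s) N (by omega) le_rfl ih).2.1
    | succ t ih => exact (key (N + s) (N + t) (by omega) (by omega) ih).2.2
  have h1 : (f (N + s, N + t)).1 = (f (N, N)).1 + s := by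
    induction s with
    | zero =>
      induction t with
      | zero => rfl
      | succ t ih =>
        exact (key N (N + t) le_rfl (by omega) (horiz 0 t)).1.trans ih
    | succ s ih => rw [← add_assoc, horiz, ih, add_assoc]
  have l1 := hl N N le_rfl le_rfl
  have l2 := hl (N + s) (N + t) (by omega) (by omega)
  exact Prod.ext h1 (by simp only; omega)

end CofiniteMono

theorem Antitone.exists_eventually_eq {g : ℕ → ℕ} (hg : Antitone g) :
    ∃ T, ∀ t, T ≤ t → g t = g T := by
  refine ⟨Function.argmin g, fun t ht => le_antisymm (hg ht) ?_⟩
  exact Function.argmin_le g t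

theorem StrictMono.add_le_nat_add {k : ℕ → ℕ} (hk : StrictMono k) (i t : ℕ) :
    k i + t ≤ k (i + t) := by
  induction t with
  | zero => simp
  | succ t ih =>
    have := hk (show i + t < i + (t + 1) by omega)
    omega

namespace CofiniteMono

variable {M : ℕ} {f : ℕ × ℕ → ℕ × ℕ}

/-- If the first coordinate is bounded on the far part of a column, then `f` eventually maps this
column into a column by a shift. -/
theorem column_eventually (h : CofiniteMono M f) (i B J₀ : ℕ)
    (hB : ∀ j, J₀ ≤ j → (f (i, j)).1 ≤ B) :
    ∃ (k : ℕ) (c : ℤ) (J : ℕ), ∀ j, J ≤ j → (f (i, j)).1 = k ∧ ((f (i, j)).2 : ℤ) = j + c := by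
  let K := J₀ + M
  have hm : ∀ s t, s ≤ t → (f (i, K + s)).1 ≤ (f (i, K + t)).1 := fun s t hst =>
    (h.mono (i, K + s) (i, K + t) (by simp only [K]; omega) ⟨le_rfl, by simp only; omega⟩).1
  have hB' : ∀ t, (f (i, K + t)).1 ≤ B := fun t => hB _ (by omega)
  have hlev : ∀ t, (f (i, K + t)).1 + (f (i, K + t)).2 ≤ i + (K + t) := fun t =>
    h.level_le (i, K + t) (by simp only [K]; omega)
  have g1 : Antitone fun t => B - (f (i, K + t)).1 := fun s t hst => by
    have := hm s t hst
    simp only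
    omega
  have g2 : Antitone fun t => i + (K + t) - ((f (i, K + t)).1 + (f (i, K + t)).2) := by
    intro s t hst
    have := h.level_add_le i (K + s) 0 (t - s) (by simp only [K]; omega)
    rw [show K + s + (t - s) = K + t by omega, add_zero] at this
    simp only
    omega
  obtain ⟨T1, hT1⟩ := g1.exists_eventually_eq
  obtain ⟨T2, hT2⟩ := g2.exists_eventually_eq
  refine ⟨(f (i, K + T1)).1, (i : ℤ) - (f (i, K + T1)).1 -
    (i + (K + T2) - ((f (i, K + T2)).1 + (f (i, K + T2)).2) : ℕ), K + T1 + T2, fun j hj => ?_⟩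
  have e1 := hT1 (j - K) (by omega)
  have e2 := hT2 (j - K) (by omega)
  have b1 := hB' (j - K)
  have b2 := hB' T1
  have b3 := hlev (j - K)
  rw [show K + (j - K) = j by omega] at e1 e2 b1 b3
  omega

/-- If `f` is a translation by `(P - N, Q - N)` on the quadrant above `(N, N)`, then the
eventual columns of the columns form a strictly increasing sequence, whence `N ≤ P`; and if
`P = N`, then this sequence is the identity. -/
theorem columns (h : CofiniteMono M f) {N P Q : ℕ} (hMN : M ≤ N)
    (hlev : P + Q = N + N)
    (htr : ∀ s t, f (N + s, N + t) = (P + s, Q + t)) :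
    N ≤ P ∧ (P = N → ∃ m : ℕ → ℕ, Antitone m ∧ (∀ i, N ≤ i → m i = 0) ∧
      ∀ i, ∃ J, ∀ j, J ≤ j → (f (i, j)).1 = i ∧ (f (i, j)).2 + m i = j) := by
  have hcol : ∀ i, ∃ (k : ℕ) (c : ℤ) (J : ℕ), ∀ j, J ≤ j →
      (f (i, j)).1 = k ∧ ((f (i, j)).2 : ℤ) = j + c := by
    intro i
    refine h.column_eventually i (P + i) N fun j hj => ?_
    have h1 := (h.mono (i, j) (N + i, j) (by simp only; omega) ⟨by simp, le_rfl⟩).1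
    have h2 := htr i (j - N)
    rw [show N + (j - N) = j by omega] at h2
    rwa [h2] at h1
  choose k c J hJ using hcol
  have hmono : ∀ i i', i ≤ i' → k i ≤ k i' ∧ c i ≤ c i' := by
    intro i i' hii
    have h1 := h.mono (i, M + J i + J i') (i', M + J i + J i') (by simp only; omega) ⟨hii, le_rfl⟩
    have h2 := hJ i (M + J i + J i') (by omega)
    have h3 := hJ i' (M + J i + J i') (by omega)
    have := h1.1
    have := h1.2
    omega
  have hk : StrictMono k := by
    intro i i' hii
    refine lt_of_le_of_ne (hmono i i' hii.le).1 fun e => ?_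
    -- Two columns shifted into the same column would overlap.
    have hc := (hmono i i' hii.le).2
    obtain ⟨d, hd⟩ := Int.eq_ofNat_of_zero_le (sub_nonneg.2 hc)
    let j := M + J i + J i'
    have h2 := hJ i (j + d) (by omega)
    have h3 := hJ i' j (by omega)
    have := h.inj (i, j + d) (i', j) (by simp only; omega) (by simp only; omega)
      (Prod.ext (by omega) (by omega))
    have := (Prod.ext_iff.1 this).1
    simp only at this
    omega
  have hfar : ∀ i, N ≤ i → k i = P + (i - N) ∧ c i = Q - N := by
    intro i hi
    have h1 := hJ i (N + J i) (by omega)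
    have h2 := htr (i - N) (J i)
    rw [show N + (i - N) = i by omega] at h2
    rw [h2] at h1
    simp only at h1
    omega
  have hN := hfar N le_rfl
  refine ⟨?_, ?_⟩
  · have := hk.le_apply (x := N)
    omega
  · rintro rfl
    have hid : ∀ i, k i = i := by
      intro i
      have h1 := hk.le_apply (x := i)
      have h2 := hk.add_le_nat_add i P
      have h3 := hfar (i + P) (by omega)
      omega
    have hc0 : ∀ i, P ≤ i → c i = 0 := fun i hi => by
      have := hfar i hi
      omega
    have hcn : ∀ i, c i ≤ 0 := fun i => by
      have := (hmono i (i + P) (by omega)).2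
      have := hc0 (i + P) (by omega)
      omega
    refine ⟨fun i => (-c i).toNat, fun i i' hii => ?_, fun i hi => ?_, fun i => ⟨J i, fun j hj => ?_⟩⟩
    · have := (hmono i i' hii).2
      simp only
      omega
    · simp [hc0 i hi]
    · have h1 := hJ i j hj
      have h2 := hcn i
      rw [hid] at h1
      refine ⟨h1.1, ?_⟩
      simp only
      omega

theorem exists_bound (J : ℕ → ℕ) (N : ℕ) : ∃ K, ∀ i, i < N → J i ≤ K :=
  ⟨(Finset.range N).sup J, fun _ hi => Finset.le_sup (Finset.mem_range.2 hi)⟩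

/-- The eventual form of a map that does not exchange the two axes. -/
theorem normal_form_of_step (h : CofiniteMono M f)
    (h0 : (f (M + M * M + 1, M + M * M)).1 = (f (M + M * M, M + M * M)).1 + 1) :
    ∃ m n : ℕ → ℕ, Antitone m ∧ Antitone n ∧ ∃ K, (∀ i, K ≤ i → m i = 0) ∧
      (∀ i, K ≤ i → n i = 0) ∧ ∀ x : ℕ × ℕ, (K ≤ x.1 ∨ K ≤ x.2) →
        (f x).1 + n x.2 = x.1 ∧ (f x).2 + m x.1 = x.2 := by
  set N := M + M * M with hN
  have hlev : ∀ x : ℕ × ℕ, N ≤ x.1 → N ≤ x.2 → (f x).1 + (f x).2 = x.1 + x.2 :=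
    fun x h1 h2 => h.level_eq x h1 h2
  have htr := h.eq_translation (by omega : M ≤ N) hlev h0
  have hPQ := hlev (N, N) le_rfl le_rfl
  have hc := h.columns (by omega : M ≤ N) hPQ htr
  have hr := h.comp_swap.swap_comp.columns (N := N) (P := (f (N, N)).2) (Q := (f (N, N)).1)
    (by omega) (by rw [add_comm]; exact hPQ) (fun s t => by simp [htr])
  have hP : (f (N, N)).1 = N := by
    have := hc.1
    have := hr.1
    simp only at hPQ
    omega
  have hQ : (f (N, N)).2 = N := by
    simp only at hPQ
    omega
  obtain ⟨m, hm, hm0, hmJ⟩ := hc.2 hP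
  obtain ⟨n, hn, hn0, hnJ⟩ := hr.2 hQ
  choose J hJ using hmJ
  choose J' hJ' using hnJ
  obtain ⟨K1, hK1⟩ := exists_bound J N
  obtain ⟨K2, hK2⟩ := exists_bound J' N
  refine ⟨m, n, hm, hn, N + K1 + K2, fun i hi => hm0 i (by omega), fun i hi => hn0 i (by omega), ?_⟩
  rintro ⟨a, b⟩ hx
  simp only at hx ⊢
  by_cases ha : a < N
  · have h1 := hJ a b (by have := hK1 a ha; omega)
    rw [hn0 b (by omega)]
    exact h1
  · by_cases hb : b < N
    · have h1 := hJ' b a (by have := hK2 b hb; omega)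
      rw [hm0 a (by omega)]
      exact ⟨h1.2, h1.1⟩
    · have h1 := htr (a - N) (b - N)
      rw [show N + (a - N) = a by omega, show N + (b - N) = b by omega, hP, hQ] at h1
      rw [h1, hm0 a (by omega), hn0 b (by omega)]
      simp only
      omega

/-- Up to an exchange of the axes, `f` eventually moves the column `i` down by `m i` and the
row `j` to the left by `n j`, with decreasing sequences `m` and `n` that are eventually zero. -/
theorem normal_form (h : CofiniteMono M f) :
    ∃ f' : ℕ × ℕ → ℕ × ℕ, (f' = f ∨ f' = fun x => (f x).swap) ∧
    ∃ m n : ℕ → ℕ, Antitone m ∧ Antitone n ∧ ∃ K, (∀ i, K ≤ i → m i = 0) ∧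
      (∀ i, K ≤ i → n i = 0) ∧ ∀ x : ℕ × ℕ, (K ≤ x.1 ∨ K ≤ x.2) →
        (f' x).1 + n x.2 = x.1 ∧ (f' x).2 + m x.1 = x.2 := by
  set N := M + M * M with hN
  have hm := h.mono (N, N) (N + 1, N) (by simp only; omega) ⟨by simp, le_rfl⟩
  have l1 := h.level_eq (N, N) hN.le hN.le
  have l2 := h.level_eq (N + 1, N) (by simp only; omega) hN.le
  have := hm.1
  have := hm.2
  simp only at l1 l2
  by_cases h0 : (f (N + 1, N)).1 = (f (N, N)).1 + 1
  · exact ⟨f, Or.inl rfl, h.normal_form_of_step h0⟩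
  · refine ⟨_, Or.inr rfl, h.swap_comp.normal_form_of_step ?_⟩
    simp only [Prod.fst_swap, ← hN]
    omega

end CofiniteMono

/-! ### Exponent functions and shifts -/

namespace FreeAM

open Classical in
/-- The sum of the exponents of `u` at the indices `t ≥ s`, in the order of `ℕ+ ⊕ ℕ+` in which
the two summands are incomparable: `shift u (Sum.inl i)` is the total exponent of
`a_i, a_(i+1), …` and `shift u (Sum.inr i)` that of `b_i, b_(i+1), …`. The monomial `u` is encoded
by the map that moves column `i` down by the former and row `i` to the left by the latter. -/
noncomputable def shift (u : FreeAM) (s : ℕ+ ⊕ ℕ+) : ℕ :=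
  (Multiplicative.toAdd u).sum fun t e => if s ≤ t then e else 0

theorem shift_mul (u v : FreeAM) (s : ℕ+ ⊕ ℕ+) : shift (u * v) s = shift u s + shift v s := by
  classical
  simp only [shift, toAdd_mul]
  refine Finsupp.sum_add_index' (by simp) fun t a b => ?_
  split_ifs <;> rfl

theorem shift_swap (u : FreeAM) (s : ℕ+ ⊕ ℕ+) : shift (swap u) s = shift u s.swap := by
  classical
  have h : Multiplicative.toAdd (swap u) =
      Finsupp.mapDomain (Equiv.sumComm ℕ+ ℕ+) (Multiplicative.toAdd u) := by
    rw [← Finsupp.equivMapDomain_eq_mapDomain]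
    rfl
  unfold shift
  rw [h, Finsupp.sum_mapDomain_index (by simp) fun _ _ _ => by split_ifs <;> rfl]
  refine Finsupp.sum_congr fun t _ => ?_
  have : s ≤ Equiv.sumComm ℕ+ ℕ+ t ↔ s.swap ≤ t := by
    rw [← Sum.swap_le_swap_iff]
    simp
  simp only [this]

theorem shift_antitone (u : FreeAM) : Antitone (shift u) := by
  classical
  intro s t hst
  refine Finset.sum_le_sum fun r _ => ?_
  by_cases h : t ≤ r
  · simp [h, hst.trans h]
  · simp [h]

/-- The exponents are the successive differences of `shift`. -/
theorem shift_eq_add (u : FreeAM) (s : ℕ+ ⊕ ℕ+) :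
    shift u s = Multiplicative.toAdd u s + shift u (s.map (· + 1) (· + 1)) := by
  classical
  have h1 : ∀ t : ℕ+ ⊕ ℕ+, ∀ e : ℕ, (if s ≤ t then e else 0) =
      (if s = t then e else 0) + if s.map (· + 1) (· + 1) ≤ t then e else 0 := by
    intro t e
    rcases s with i | i <;> rcases t with j | j <;>
      simp only [Sum.map_inl, Sum.map_inr, Sum.inl_le_inl_iff, Sum.inr_le_inr_iff,
        Sum.inl.injEq, Sum.inr.injEq, PNat.add_one_le_iff, Sum.not_inl_le_inr,
        Sum.not_inr_le_inl, reduceCtorEq, if_false]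
    all_goals
      rcases lt_trichotomy i j with h | rfl | h
      · simp [h, h.le, h.ne]
      · simp
      · simp [h.not_ge, h.ne', h.not_gt]
  unfold shift
  simp only [h1, Finsupp.sum_add, Finsupp.sum_ite_eq, Finsupp.mem_support_iff]
  congr 1
  split_ifs with h
  · rfl
  · exact (not_not.1 h).symm

/-- The numerical value of an index of a generator. -/
def index : ℕ+ ⊕ ℕ+ → ℕ := Sum.elim (fun i => i) (fun i => i)

theorem index_map_add_one (s : ℕ+ ⊕ ℕ+) : index (s.map (· + 1) (· + 1)) = index s + 1 := by
  rcases s with i | i <;> simp [index]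

theorem shift_eventually_zero (u : FreeAM) : ∃ N, ∀ s, N ≤ index s → shift u s = 0 := by
  classical
  refine ⟨(Multiplicative.toAdd u).support.sup index + 1, fun s hs => ?_⟩
  refine Finset.sum_eq_zero fun t ht => if_neg fun hst => ?_
  have h1 : index t ≤ _ := Finset.le_sup (f := index) ht
  have h2 : index s ≤ index t := by
    rcases s with i | i <;> rcases t with j | j <;> simp at hst <;> exact hst
  omega

theorem ext_shift {u v : FreeAM} (h : ∀ s, shift u s = shift v s) : u = v := by
  refine Multiplicative.toAdd.injective (Finsupp.ext fun s => ?_)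
  have h1 := shift_eq_add u s
  have h2 := shift_eq_add v s
  rw [h, h] at h1
  omega

theorem exists_shift_eq (h : ℕ+ ⊕ ℕ+ → ℕ) (hanti : ∀ s, h (s.map (· + 1) (· + 1)) ≤ h s)
    (N : ℕ) (hN : ∀ s, N ≤ index s → h s = 0) : ∃ u : FreeAM, ∀ s, shift u s = h s := by
  have hfin : (Function.support fun s => h s - h (s.map (· + 1) (· + 1))).Finite := by
    refine (((Set.finite_Iic N.succPNat).image Sum.inl).union
      ((Set.finite_Iic N.succPNat).image Sum.inr)).subset fun s hs => ?_
    have hs' : index s < N := by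
      by_contra hc
      simp [hN s (not_lt.1 hc)] at hs
    rcases s with i | i
    · refine Or.inl ⟨i, ?_, rfl⟩
      rw [Set.mem_Iic, ← PNat.coe_le_coe, Nat.succPNat_coe]
      exact hs'.le.trans N.le_succ
    · refine Or.inr ⟨i, ?_, rfl⟩
      rw [Set.mem_Iic, ← PNat.coe_le_coe, Nat.succPNat_coe]
      exact hs'.le.trans N.le_succ
  let u : FreeAM := Multiplicative.ofAdd (Finsupp.ofSupportFinite _ hfin)
  have hu : ∀ s, Multiplicative.toAdd u s = h s - h (s.map (· + 1) (· + 1)) := fun s => rfl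
  obtain ⟨N', hN'⟩ := shift_eventually_zero u
  refine ⟨u, fun s => ?_⟩
  -- Descending induction on the index, from a point where both sides vanish.
  obtain ⟨d, hd⟩ : ∃ d, N + N' ≤ index s + d := ⟨N + N', by omega⟩
  induction d generalizing s with
  | zero => rw [hN s (by omega), hN' s (by omega)]
  | succ d ih =>
    have := hanti s
    rw [shift_eq_add, hu, ih _ (by rw [index_map_add_one]; omega)]
    omega

end FreeAM

/-! ### Normal forms of partial maps -/

namespace POInf

open FreeAM

theorem exists_bound_of_finite {S : Set (ℕ+ × ℕ+)} (hS : S.Finite) :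
    ∃ K : ℕ, ∀ x : ℕ+ × ℕ+, (K ≤ x.1 ∨ K ≤ x.2) → x ∉ S := by
  obtain ⟨b, hb⟩ := hS.bddAbove
  refine ⟨b.1 + b.2 + 1, fun x hx hxS => ?_⟩
  have h := hb hxS
  have h1 : (x.1 : ℕ) ≤ b.1 := h.1
  have h2 : (x.2 : ℕ) ≤ b.2 := h.2
  omega

theorem finite_of_bound {S : Set (ℕ+ × ℕ+)} (K : ℕ)
    (h : ∀ x : ℕ+ × ℕ+, (K ≤ x.1 ∨ K ≤ x.2) → x ∉ S) : S.Finite := by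
  refine (Set.finite_Iic (K.succPNat, K.succPNat)).subset fun x hx => ?_
  have h1 : ¬ (K ≤ x.1 ∨ K ≤ x.2) := fun h' => h x h' hx
  constructor <;> rw [← PNat.coe_le_coe] <;> simp only [Nat.succPNat_coe] <;> omega

/-- The identity for `g = 0`, the exchange of coordinates for `g = 1`. -/
def orient (g : Multiplicative (ZMod 2)) (y : ℕ+ × ℕ+) : ℕ+ × ℕ+ :=
  if g = Multiplicative.ofAdd 0 then y else y.swap

theorem orient_zero (y : ℕ+ × ℕ+) : orient (Multiplicative.ofAdd 0) y = y := rfl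

theorem orient_one (y : ℕ+ × ℕ+) : orient (Multiplicative.ofAdd 1) y = y.swap := rfl

theorem eq_zero_or_one (g : Multiplicative (ZMod 2)) :
    g = Multiplicative.ofAdd 0 ∨ g = Multiplicative.ofAdd 1 := by
  revert g
  decide

theorem orient_orient (g : Multiplicative (ZMod 2)) (y : ℕ+ × ℕ+) : orient g (orient g y) = y := by
  rcases eq_zero_or_one g with rfl | rfl
  · rfl
  · rfl

theorem orient_le (g : Multiplicative (ZMod 2)) {y z : ℕ+ × ℕ+} (h : y ≤ z) :
    orient g y ≤ orient g z := by
  rcases eq_zero_or_one g with rfl | rfl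
  · exact h
  · exact Prod.swap_le_swap.2 h

/-- The semidirect product of the free commutative monoid with `ℤ₂`. -/
abbrev Model : Type := MonoidSemidirect FreeAM (Multiplicative (ZMod 2)) FreeAM.action

/-- `α` has the normal form `(u, g)` if outside a finite set it moves column `i` down by
`shift u (Sum.inl i)` and row `j` to the left by `shift u (Sum.inr j)`, and then exchanges the
coordinates if `g = 1`. -/
def HasNormalForm (α : POInf) (p : Model) : Prop :=
  ∃ K : ℕ, ∀ x : ℕ+ × ℕ+, (K ≤ x.1 ∨ K ≤ x.2) → ∃ y ∈ α.map x,
    ((orient p.right y).1 : ℕ) + shift p.left (Sum.inr x.2) = x.1 ∧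
    ((orient p.right y).2 : ℕ) + shift p.left (Sum.inl x.1) = x.2

theorem HasNormalForm.unique {α : POInf} {p q : Model} (hp : HasNormalForm α p)
    (hq : HasNormalForm α q) : p = q := by
  obtain ⟨u, g⟩ := p
  obtain ⟨v, k⟩ := q
  obtain ⟨K, hK⟩ := hp
  obtain ⟨K', hK'⟩ := hq
  obtain ⟨N, hN⟩ := shift_eventually_zero u
  obtain ⟨N', hN'⟩ := shift_eventually_zero v
  simp only at hK hK'
  let B : ℕ+ := (K + K' + N + N').succPNat
  have hB : (B : ℕ) = K + K' + N + N' + 1 := rfl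
  have zero : ∀ i : ℕ+, B ≤ i → shift u (Sum.inl i) = 0 ∧ shift u (Sum.inr i) = 0 ∧
      shift v (Sum.inl i) = 0 ∧ shift v (Sum.inr i) = 0 := by
    intro i hi
    rw [← PNat.coe_le_coe] at hi
    refine ⟨hN _ ?_, hN _ ?_, hN' _ ?_, hN' _ ?_⟩ <;> simp only [index, Sum.elim_inl, Sum.elim_inr]
      <;> omega
  -- A point off the diagonal and far from both axes determines the orientation.
  have hgk : g = k := by
    obtain ⟨y, hy, h1, h2⟩ := hK (B, B + 1) (by simp only; omega)
    obtain ⟨y', hy', h3, h4⟩ := hK' (B, B + 1) (by simp only; omega)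
    obtain rfl := Option.mem_unique hy hy'
    have z1 := zero B le_rfl
    have z2 := zero (B + 1) (PNat.lt_add_right B 1).le
    simp only [z1, z2, PNat.add_coe, PNat.one_coe] at h1 h2 h3 h4
    rcases eq_zero_or_one g with rfl | rfl <;> rcases eq_zero_or_one k with rfl | rfl <;>
      simp only [orient_zero, orient_one, Prod.fst_swap, Prod.snd_swap] at h1 h2 h3 h4 <;>
      first | rfl | omega
  subst hgk
  have huv : u = v := by
    refine ext_shift fun s => ?_
    rcases s with i | i
    · obtain ⟨y, hy, -, h1⟩ := hK (i, B) (by simp only; omega)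
      obtain ⟨y', hy', -, h2⟩ := hK' (i, B) (by simp only; omega)
      obtain rfl := Option.mem_unique hy hy'
      simp only at h1 h2
      omega
    · obtain ⟨y, hy, h1, -⟩ := hK (B, i) (by simp only; omega)
      obtain ⟨y', hy', h2, -⟩ := hK' (B, i) (by simp only; omega)
      obtain rfl := Option.mem_unique hy hy'
      simp only at h1 h2
      omega
  rw [huv]

/-- A shift does not affect later shifts: moving a far point of a column down does not change
its column, and its row remains beyond all the rows that are moved. -/
theorem shift_stable (u v : FreeAM) : ∃ K : ℕ, ∀ x z : ℕ+ × ℕ+, (K ≤ x.1 ∨ K ≤ x.2) →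
    (z.1 : ℕ) + shift u (Sum.inr x.2) = x.1 → (z.2 : ℕ) + shift u (Sum.inl x.1) = x.2 →
    shift v (Sum.inr z.2) = shift v (Sum.inr x.2) ∧
    shift v (Sum.inl z.1) = shift v (Sum.inl x.1) := by
  obtain ⟨N, hN⟩ := shift_eventually_zero u
  obtain ⟨N', hN'⟩ := shift_eventually_zero v
  refine ⟨N + N' + shift u (Sum.inl 1) + shift u (Sum.inr 1), fun x z hx h1 h2 => ?_⟩
  have b1 : shift u (Sum.inl x.1) ≤ shift u (Sum.inl 1) :=
    shift_antitone u (Sum.inl_le_inl_iff.2 one_le)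
  have b2 : shift u (Sum.inr x.2) ≤ shift u (Sum.inr 1) :=
    shift_antitone u (Sum.inr_le_inr_iff.2 one_le)
  have r : ∀ i : ℕ+, N' ≤ i → shift v (Sum.inr i) = 0 := fun i hi => hN' _ hi
  have l : ∀ i : ℕ+, N' ≤ i → shift v (Sum.inl i) = 0 := fun i hi => hN' _ hi
  rcases hx with hx | hx
  · have h0 : shift u (Sum.inl x.1) = 0 := hN _ (by simp only [index, Sum.elim_inl]; omega)
    have : z.2 = x.2 := PNat.eq (by omega)
    rw [this, l x.1 (by omega), l z.1 (by omega)]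
    exact ⟨rfl, rfl⟩
  · have h0 : shift u (Sum.inr x.2) = 0 := hN _ (by simp only [index, Sum.elim_inr]; omega)
    have : z.1 = x.1 := PNat.eq (by omega)
    rw [this, r x.2 (by omega), r z.2 (by omega)]
    exact ⟨rfl, rfl⟩

theorem finite_preimage (α : POInf) {S : Set (ℕ+ × ℕ+)} (hS : S.Finite) :
    {x | ∃ y ∈ S, y ∈ α.map x}.Finite := by
  have : {x | ∃ y ∈ S, y ∈ α.map x} ⊆ ⋃ y ∈ S, {x | y ∈ α.map x} := by
    intro x hx
    simpa using hx
  refine (hS.biUnion fun y _ => ?_).subset this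
  exact Set.Subsingleton.finite fun a ha b hb => α.map.inj ha hb

theorem HasNormalForm.mul {α β : POInf} {p q : Model} (hp : HasNormalForm α p)
    (hq : HasNormalForm β q) : HasNormalForm (α * β) (p * q) := by
  obtain ⟨u, g⟩ := p
  obtain ⟨v, k⟩ := q
  obtain ⟨K, hK⟩ := hp
  obtain ⟨K', hK'⟩ := hq
  obtain ⟨K₁, hK₁⟩ := shift_stable u v
  obtain ⟨K₂, hK₂⟩ := shift_stable u (swap v)
  obtain ⟨K₃, hK₃⟩ := exists_bound_of_finite (α.finite_preimage
    (S := {y | ¬ (K' ≤ y.1 ∨ K' ≤ y.2)}) (finite_of_bound K' fun x hx h => h hx))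
  simp only [MonoidSemidirect.mul_def] at hK hK' ⊢
  refine ⟨K + K₁ + K₂ + K₃, fun x hx => ?_⟩
  obtain ⟨y, hy, h1, h2⟩ := hK x (by omega)
  have hy' : K' ≤ y.1 ∨ K' ≤ y.2 := by
    by_contra hc
    exact hK₃ x (by omega) ⟨y, hc, hy⟩
  obtain ⟨z, hz, h3, h4⟩ := hK' y hy'
  refine ⟨z, (PEquiv.mem_trans _ _ _ _).2 ⟨y, hy, hz⟩, ?_⟩
  simp only [shift_mul]
  rcases eq_zero_or_one g with rfl | rfl
  · have h5 := hK₁ x y (by omega) h1 h2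
    have e1 : FreeAM.action (Multiplicative.ofAdd 0) = 1 := rfl
    have e2 : Multiplicative.ofAdd 0 * k = k := one_mul k
    simp only [orient_zero] at h1 h2
    simp only [e1, e2, MulAut.one_apply]
    omega
  · have h5 := hK₂ x y.swap (by omega) h1 h2
    have e1 : FreeAM.action (Multiplicative.ofAdd 1) = swap := rfl
    have e2 : orient (Multiplicative.ofAdd 1 * k) z = (orient k z).swap := by
      rcases eq_zero_or_one k with rfl | rfl <;> rfl
    simp only [orient_one, Prod.fst_swap, Prod.snd_swap, shift_swap, Sum.swap_inl,
      Sum.swap_inr] at h1 h2 h5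
    simp only [e1, e2, shift_swap, Prod.fst_swap, Prod.snd_swap, Sum.swap_inl, Sum.swap_inr]
    omega

/-- The partial identity with a given cofinite domain. -/
theorem exists_idempotent_of_cofinite {s : Set (ℕ+ × ℕ+)} (hs : sᶜ.Finite) :
    ∃ ε : POInf, IsIdempotentElem ε ∧ ∀ x, x ∈ ε.map x ↔ x ∈ s := by
  classical
  have hmem : ∀ x y, y ∈ PEquiv.ofSet s x ↔ x = y ∧ x ∈ s := fun x y => by
    rw [PEquiv.mem_ofSet_iff, eq_comm]
    exact ⟨fun h => ⟨h.1, h.1.symm ▸ h.2⟩, fun h => ⟨h.1, h.1 ▸ h.2⟩⟩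
  have hdom : {x : ℕ+ × ℕ+ | ∃ y, y ∈ PEquiv.ofSet s x} = s := by
    ext x; simp [hmem]
  have hran : {y : ℕ+ × ℕ+ | ∃ x, y ∈ PEquiv.ofSet s x} = s := by
    ext x; simp [hmem]
  let ε : POInf :=
    { map := PEquiv.ofSet s
      monotone' := by
        intro x y x' y' hx hy hxy
        obtain ⟨rfl, -⟩ := (hmem _ _).1 hx
        obtain ⟨rfl, -⟩ := (hmem _ _).1 hy
        exact hxy
      cofinite_dom := by rwa [hdom]
      cofinite_ran := by rwa [hran] }
  refine ⟨ε, ext_mem fun x y => ?_, fun x => (hmem x x).trans (and_iff_right rfl)⟩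
  rw [mul_map, PEquiv.mem_trans]
  constructor
  · rintro ⟨z, hz, hz'⟩
    obtain ⟨rfl, -⟩ := (hmem _ _).1 hz
    exact hz'
  · intro h
    obtain ⟨rfl, -⟩ := (hmem _ _).1 h
    exact ⟨x, h, h⟩

theorem HasNormalForm.sigma {α β : POInf} {p : Model} (hα : HasNormalForm α p)
    (hβ : HasNormalForm β p) : POInf.sigma α β := by
  obtain ⟨K, hK⟩ := hα
  obtain ⟨K', hK'⟩ := hβ
  let box : Set (ℕ+ × ℕ+) := {x | ¬ (K + K' ≤ x.1 ∨ K + K' ≤ x.2)}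
  have hbox : box.Finite := finite_of_bound (K + K') fun x hx h => h hx
  have heq : ∀ x ∉ box, α.map x = β.map x := by
    intro x hx
    have hx' := not_not.1 hx
    obtain ⟨y, hy, h1, h2⟩ := hK x (by omega)
    obtain ⟨z, hz, h3, h4⟩ := hK' x (by omega)
    have hyz : orient p.right y = orient p.right z :=
      Prod.ext (PNat.eq (by omega)) (PNat.eq (by omega))
    have : y = z := by rw [← orient_orient p.right y, hyz, orient_orient]
    rw [Option.mem_def.1 hy, Option.mem_def.1 hz, this]
  let s : Set (ℕ+ × ℕ+) := {y | ∀ x, y ∈ α.map x ↔ y ∈ β.map x}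
  have hs : sᶜ.Finite := by
    have hf : ∀ γ : POInf, (⋃ x ∈ box, {y | y ∈ γ.map x}).Finite := fun γ =>
      hbox.biUnion fun x _ => Set.Subsingleton.finite fun a ha b hb => Option.mem_unique ha hb
    refine ((hf α).union (hf β)).subset fun y hy => ?_
    obtain ⟨x, hx⟩ := not_forall.1 hy
    have hxb : x ∈ box := by
      by_contra hc
      exact hx (by rw [heq x hc])
    by_cases ha : y ∈ α.map x
    · exact Or.inl (Set.mem_biUnion hxb ha)
    · refine Or.inr (Set.mem_biUnion hxb ?_)
      by_contra hb
      exact hx ⟨fun h => absurd h ha, fun h => absurd h hb⟩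
  obtain ⟨ε, hε, hεs⟩ := exists_idempotent_of_cofinite hs
  refine ⟨ε, hε, ext_mem fun x y => ?_⟩
  rw [mem_mul_idempotent hε, mem_mul_idempotent hε, hεs]
  exact and_congr_left fun hy => hy x

theorem HasNormalForm.of_sigma {α β : POInf} {p : Model} (hα : HasNormalForm α p)
    (h : POInf.sigma α β) : HasNormalForm β p := by
  obtain ⟨ε, hε, he⟩ := h
  obtain ⟨K, hK⟩ := hα
  obtain ⟨K', hK'⟩ := exists_bound_of_finite (α.finite_preimage ε.cofinite_dom)
  refine ⟨K + K', fun x hx => ?_⟩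
  obtain ⟨y, hy, h1⟩ := hK x (by omega)
  have hyε : ∃ z, z ∈ ε.map y := by
    by_contra hc
    exact hK' x (by omega) ⟨y, hc, hy⟩
  obtain ⟨z, hz⟩ := hyε
  obtain rfl := eq_of_idempotent hε hz
  have h2 := (mem_mul_idempotent hε).2 ⟨hy, hz⟩
  rw [he] at h2
  exact ⟨z, ((mem_mul_idempotent hε).1 h2).1, h1⟩

/-- Every pair `(u, g)` is a normal form: the formula defines a monotone injection outside a
sufficiently large box. -/
theorem exists_of_normalForm (p : Model) : ∃ α, HasNormalForm α p := by
  classical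
  obtain ⟨u, g⟩ := p
  obtain ⟨N, hN⟩ := shift_eventually_zero u
  obtain ⟨K, hK⟩ := shift_stable u u
  let S := shift u (Sum.inl 1) + shift u (Sum.inr 1)
  let C := K + N + S + 1
  have b1 : ∀ i, shift u (Sum.inl i) ≤ S := fun i =>
    (shift_antitone u (Sum.inl_le_inl_iff.2 one_le)).trans (Nat.le_add_right _ _)
  have b2 : ∀ i, shift u (Sum.inr i) ≤ S := fun i =>
    (shift_antitone u (Sum.inr_le_inr_iff.2 one_le)).trans (Nat.le_add_left _ _)
  have z1 : ∀ i : ℕ+, N ≤ i → shift u (Sum.inl i) = 0 := fun i hi => hN _ hi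
  have z2 : ∀ i : ℕ+, N ≤ i → shift u (Sum.inr i) = 0 := fun i hi => hN _ hi
  let f : ℕ+ × ℕ+ → ℕ+ × ℕ+ := fun x =>
    (Nat.toPNat' (x.1 - shift u (Sum.inr x.2)), Nat.toPNat' (x.2 - shift u (Sum.inl x.1)))
  let r : ℕ+ × ℕ+ → ℕ+ × ℕ+ := fun y =>
    (⟨y.1 + shift u (Sum.inr y.2), by have := y.1.pos; omega⟩,
      ⟨y.2 + shift u (Sum.inl y.1), by have := y.2.pos; omega⟩)
  have hf : ∀ x : ℕ+ × ℕ+, (C ≤ x.1 ∨ C ≤ x.2) →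
      ((f x).1 : ℕ) + shift u (Sum.inr x.2) = x.1 ∧
      ((f x).2 : ℕ) + shift u (Sum.inl x.1) = x.2 := by
    intro x hx
    have c1 := b1 x.1
    have c2 := b2 x.2
    have p1 := x.1.pos
    have p2 := x.2.pos
    have d1 := z1 x.1
    have d2 := z2 x.2
    simp only [f, Nat.toPNat'_coe]
    split_ifs <;> omega
  have hrf : ∀ x : ℕ+ × ℕ+, (C ≤ x.1 ∨ C ≤ x.2) → r (f x) = x := by
    intro x hx
    have h1 := hf x hx
    have h2 := hK x (f x) (by omega) h1.1 h1.2
    refine Prod.ext (PNat.eq ?_) (PNat.eq ?_)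
    · change ((f x).1 : ℕ) + shift u (Sum.inr (f x).2) = x.1
      omega
    · change ((f x).2 : ℕ) + shift u (Sum.inl (f x).1) = x.2
      omega
  have hfr : ∀ y : ℕ+ × ℕ+, (C ≤ y.1 ∨ C ≤ y.2) → f (r y) = y := by
    intro y hy
    have r1 : ((r y).1 : ℕ) = y.1 + shift u (Sum.inr y.2) := rfl
    have r2 : ((r y).2 : ℕ) = y.2 + shift u (Sum.inl y.1) := rfl
    have h1 := hf (r y) (by omega)
    have h2 : shift u (Sum.inr (r y).2) = shift u (Sum.inr y.2) ∧
        shift u (Sum.inl (r y).1) = shift u (Sum.inl y.1) := by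
      rcases hy with hy | hy
      · have h0 := z1 y.1 (by omega)
        have : (r y).2 = y.2 := PNat.eq (by omega)
        rw [this, h0, z1 (r y).1 (by omega)]
        exact ⟨rfl, rfl⟩
      · have h0 := z2 y.2 (by omega)
        have : (r y).1 = y.1 := PNat.eq (by omega)
        rw [this, h0, z2 (r y).2 (by omega)]
        exact ⟨rfl, rfl⟩
    exact Prod.ext (PNat.eq (by omega)) (PNat.eq (by omega))
  let e : (ℕ+ × ℕ+) ≃. (ℕ+ × ℕ+) :=
    { toFun := fun x => if C ≤ x.1 ∨ C ≤ x.2 then some (orient g (f x)) else none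
      invFun := fun y => if (C ≤ (r (orient g y)).1 ∨ C ≤ (r (orient g y)).2) ∧
        f (r (orient g y)) = orient g y then some (r (orient g y)) else none
      inv := by
        intro x y
        simp only [Option.ite_none_right_eq_some, Option.some.injEq]
        constructor
        · rintro ⟨⟨h1, h2⟩, rfl⟩
          exact ⟨h1, by rw [h2, orient_orient]⟩
        · rintro ⟨h1, rfl⟩
          rw [orient_orient, hrf x h1]
          exact ⟨⟨h1, rfl⟩, rfl⟩ }
  have he : ∀ x y, y ∈ e x ↔ (C ≤ x.1 ∨ C ≤ x.2) ∧ orient g (f x) = y := by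
    intro x y
    simp only [e, PEquiv.coe_mk, Option.mem_def, Option.ite_none_right_eq_some, Option.some.injEq]
  let α : POInf :=
    { map := e
      monotone' := by
        intro x y x' y' hx hy hxy
        obtain ⟨hx1, rfl⟩ := (he _ _).1 hx
        obtain ⟨hy1, rfl⟩ := (he _ _).1 hy
        have h1 := hf x hx1
        have h2 := hf y hy1
        have a1 := shift_antitone u (Sum.inl_le_inl_iff.2 hxy.1)
        have a2 := shift_antitone u (Sum.inr_le_inr_iff.2 hxy.2)
        have c1 : (x.1 : ℕ) ≤ y.1 := hxy.1
        have c2 : (x.2 : ℕ) ≤ y.2 := hxy.2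
        refine orient_le g ⟨?_, ?_⟩ <;> rw [← PNat.coe_le_coe] <;> omega
      cofinite_dom := finite_of_bound C fun x hx h => h ⟨_, (he _ _).2 ⟨hx, rfl⟩⟩
      cofinite_ran := finite_of_bound C fun y hy h => by
        have hy' : C ≤ (orient g y).1 ∨ C ≤ (orient g y).2 := by
          rcases eq_zero_or_one g with rfl | rfl
          · exact hy
          · exact hy.symm
        refine h ⟨r (orient g y), (he _ _).2 ⟨?_, by rw [hfr _ hy', orient_orient]⟩⟩
        exact hy'.imp (fun h => h.trans (Nat.le_add_right _ _))
          (fun h => h.trans (Nat.le_add_right _ _)) }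
  refine ⟨α, C, fun x hx => ⟨_, (he _ _).2 ⟨hx, rfl⟩, ?_⟩⟩
  simp only [orient_orient]
  exact hf x hx

/-- The order isomorphism between the positive integers and the naturals turns a partial map into
a map of `ℕ × ℕ` that is controlled outside a box. -/
theorem exists_cofiniteMono (α : POInf) : ∃ (M : ℕ) (f : ℕ × ℕ → ℕ × ℕ), CofiniteMono M f ∧
    ∀ x : ℕ × ℕ, (M ≤ x.1 ∨ M ≤ x.2) →
      ((f x).1.succPNat, (f x).2.succPNat) ∈ α.map (x.1.succPNat, x.2.succPNat) := by
  classical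
  obtain ⟨M, hM⟩ := exists_bound_of_finite α.cofinite_dom
  have hex : ∀ x : ℕ × ℕ, ∃ y : ℕ × ℕ, (M ≤ x.1 ∨ M ≤ x.2) →
      (y.1.succPNat, y.2.succPNat) ∈ α.map (x.1.succPNat, x.2.succPNat) := by
    intro x
    by_cases hx : M ≤ x.1 ∨ M ≤ x.2
    · obtain ⟨y, hy⟩ := not_not.1 (hM (x.1.succPNat, x.2.succPNat)
        (by simp only [Nat.succPNat_coe]; omega))
      refine ⟨(y.1.natPred, y.2.natPred), fun _ => ?_⟩
      simpa using hy
    · exact ⟨x, fun h => absurd h hx⟩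
  choose f hf using hex
  refine ⟨M, f, ⟨?_, ?_, ?_⟩, hf⟩
  · intro x y hx hxy
    have h := α.monotone' _ _ _ _ (hf x hx)
      (hf y (hx.imp (fun h => h.trans hxy.1) (fun h => h.trans hxy.2)))
      ⟨Nat.succPNat_le_succPNat.2 hxy.1, Nat.succPNat_le_succPNat.2 hxy.2⟩
    exact ⟨Nat.succPNat_le_succPNat.1 h.1, Nat.succPNat_le_succPNat.1 h.2⟩
  · intro x y hx hy h
    have h1 := hf x hx
    rw [h] at h1
    have h2 := Prod.ext_iff.1 (α.map.inj h1 (hf y hy))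
    exact Prod.ext (Nat.succPNat_injective h2.1) (Nat.succPNat_injective h2.2)
  · -- Finitely many values are missing from the range or have their preimage in the box.
    have hbox : {y | ∃ x : ℕ+ × ℕ+, ¬ (M + 1 ≤ x.1 ∨ M + 1 ≤ x.2) ∧ y ∈ α.map x}.Finite := by
      have hb : {x : ℕ+ × ℕ+ | ¬ (M + 1 ≤ x.1 ∨ M + 1 ≤ x.2)}.Finite :=
        finite_of_bound (M + 1) fun x hx h => h hx
      refine (hb.biUnion (t := fun x => {y | y ∈ α.map x}) fun x _ =>
        Set.Subsingleton.finite fun a ha b hb => Option.mem_unique ha hb).subset fun y hy => ?_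
      obtain ⟨x, hx, hy⟩ := hy
      exact Set.mem_biUnion hx hy
    obtain ⟨L, hL⟩ := exists_bound_of_finite (α.cofinite_ran.union hbox)
    refine ⟨L, fun y hy => ?_⟩
    have h1 := hL (y.1.succPNat, y.2.succPNat) (by simp only [Nat.succPNat_coe]; omega)
    rw [Set.mem_union, not_or] at h1
    obtain ⟨x, hx⟩ := not_not.1 h1.1
    have hxM : M + 1 ≤ x.1 ∨ M + 1 ≤ x.2 := by
      by_contra hc
      exact h1.2 ⟨x, hc, hx⟩
    have e1 := PNat.natPred_add_one x.1
    have e2 := PNat.natPred_add_one x.2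
    have hx' : M ≤ x.1.natPred ∨ M ≤ x.2.natPred := by omega
    refine ⟨(x.1.natPred, x.2.natPred), hx', ?_⟩
    have h2 := hf (x.1.natPred, x.2.natPred) hx'
    simp only [PNat.succPNat_natPred, Prod.mk.eta] at h2
    have h3 := Prod.ext_iff.1 (Option.mem_unique h2 hx)
    exact Prod.ext (Nat.succPNat_injective h3.1) (Nat.succPNat_injective h3.2)

theorem exists_normalForm (α : POInf) : ∃ p, HasNormalForm α p := by
  obtain ⟨M, f, hf, hα⟩ := α.exists_cofiniteMono
  obtain ⟨f', hf', m, n, hm, hn, K, hm0, hn0, hK⟩ := hf.normal_form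
  obtain ⟨u, hu⟩ := exists_shift_eq (Sum.elim (fun i => m i.natPred) (fun i => n i.natPred))
    (by
      rintro (i | i)
      · exact hm (PNat.natPred_monotone (PNat.lt_add_right i 1).le)
      · exact hn (PNat.natPred_monotone (PNat.lt_add_right i 1).le))
    (K + 1)
    (by
      rintro (i | i) hi <;> simp only [index, Sum.elim_inl, Sum.elim_inr] at hi ⊢ <;>
        have := PNat.natPred_add_one i
      · exact hm0 _ (by omega)
      · exact hn0 _ (by omega))
  have hg : ∃ g : Multiplicative (ZMod 2), ∀ x,
      orient g ((f x).1.succPNat, (f x).2.succPNat) = ((f' x).1.succPNat, (f' x).2.succPNat) := by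
    rcases hf' with rfl | rfl
    · exact ⟨Multiplicative.ofAdd 0, fun x => rfl⟩
    · exact ⟨Multiplicative.ofAdd 1, fun x => rfl⟩
  obtain ⟨g, hg⟩ := hg
  refine ⟨⟨u, g⟩, K + M + 1, fun x hx => ?_⟩
  have e1 := PNat.natPred_add_one x.1
  have e2 := PNat.natPred_add_one x.2
  have h1 := hα (x.1.natPred, x.2.natPred) (by simp only; omega)
  have h2 := hK (x.1.natPred, x.2.natPred) (by simp only; omega)
  simp only [PNat.succPNat_natPred, Prod.mk.eta] at h1 h2
  refine ⟨_, h1, ?_⟩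
  simp only [hg, hu, Nat.succPNat_coe, Sum.elim_inl, Sum.elim_inr]
  omega

/-! ### The isomorphism -/

/-- The homomorphism that sends a partial map to its normal form. -/
noncomputable def normalForm : POInf →* Model where
  toFun α := α.exists_normalForm.choose
  map_one' := by
    refine (exists_normalForm 1).choose_spec.unique ⟨0, fun x _ => ⟨x, rfl, ?_⟩⟩
    have h : ∀ s, shift (1 : FreeAM) s = 0 := fun s => Finsupp.sum_zero_index
    simp only [MonoidSemidirect.one_def, h]
    exact ⟨rfl, rfl⟩
  map_mul' α β := (exists_normalForm (α * β)).choose_spec.unique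
    (α.exists_normalForm.choose_spec.mul β.exists_normalForm.choose_spec)

theorem hasNormalForm_normalForm (α : POInf) : HasNormalForm α (normalForm α) :=
  α.exists_normalForm.choose_spec

theorem normalForm_surjective : Function.Surjective normalForm := fun p => by
  obtain ⟨α, hα⟩ := exists_of_normalForm p
  exact ⟨α, α.hasNormalForm_normalForm.unique hα⟩

theorem sigma_eq_ker : POInf.sigma = Con.ker normalForm := by
  refine Con.ext fun α β => ?_
  rw [Con.ker_rel]
  constructor
  · intro h
    exact (α.hasNormalForm_normalForm.of_sigma h).unique β.hasNormalForm_normalForm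
  · intro h
    have hα := α.hasNormalForm_normalForm
    rw [h] at hα
    exact hα.sigma β.hasNormalForm_normalForm

end POInf

theorem theorem2p20 :
    Nonempty (POInf.sigma.Quotient ≃*
      MonoidSemidirect FreeAM (Multiplicative (ZMod 2)) FreeAM.action) := by
  rw [POInf.sigma_eq_ker]
  exact ⟨Con.quotientKerEquivOfSurjective POInf.normalForm POInf.normalForm_surjective⟩
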